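/- Let $G$ be a finite graph without loops or multiple edges, with vertex set $V(G)$ and $m$ edges, and let $D(G)$ be the set of its $2m$ arcs (each edge $uv$ gives the arcs $(u,v)$ and $(v,u)$). For $e=(u,v)\in D(G)$ write $o(e)=u$, $t(e)=v$, $e^{-1}=(v,u)$. Let $\mathbf W=(\mathbf W_{uv})_{u,v\in V(G)}$ be a matrix of real quaternions with $\mathbf W_{uv}=0$ whenever $(u,v)\notin D(G)$, and put $w(e)=\mathbf W_{uv}$ for $e=(u,v)\in D(G)$. Define matrices $\mathbf B_w,\mathbf J_0$ indexed by $D(G)$ by $(\mathbf B_w)_{ef}=w(f)$ if $t(e)=o(f)$ and $0$ otherwise, $(\mathbf J_0)_{ef}=1$ if $f=e^{-1}$ and $0$ otherwise, and let $\tilde w(e,f)$ be the $(e,f)$-entry of $\mathbf B_w-\mathbf J_0$. For a square quaternionic matrix $\mathbf M=\mathbf M^S+j\mathbf M^P$ with $\mathbf M^S,\mathbf M^P$ complex, let $$\operatorname{Sdet}(\mathbf M)=\det\begin{bmatrix}\mathbf M^S&-\overline{\mathbf M^P}\\ \mathbf M^P&\overline{\mathbf M^S}\end{bmatrix}$$ be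 its Study determinant, and for a quaternion $t$ let $$\mathbf Z^{\mathbb H}_1(G,w,t)=\operatorname{Sdet}\big(\mathbf I_{2m}-t(\mathbf B_w-\mathbf J_0)\big)^{-1}.$$ Let $e_1,\dots,e_{2m}$ be any enumeration of $D(G)$. Let $L_{[2m]}$ be the set of Lyndon words over $[2m]=\{1<2<\dots<2m\}$, that is, of nonempty words that are not a power $u^r$ $(r\ge 2)$ of a word $u$ and are lexicographically minimal among their cyclic rearrangements. **Theorem.** Let $t$ be a quaternion with $|t|$ so small that $|t\,\tilde w(e,f)|<1/(8m^2)$ for all $e,f\in D(G)$ (no condition if $m=0$). Then $\operatorname{Sdet}(\mathbf I_{2m}-t(\mathbf B_w-\mathbf J_0))\neq 0$, and $$\mathbf Z^{\mathbb H}_1(G,w,t)=\prod_{i_1i_2\cdots i_d\in L_{[2m]}}\big|1-t\tilde w(e_{i_1},e_{i_2})\,t\tilde w(e_{i_2},e_{i_3})\cdots t\tilde w(e_{i_d},e_{i_1})\big|^{-2},$$ where for $d=1$ the product inside is $t\tilde w(e_{i_1},e_{i_1})$. Here every factor is defined (the quaternion inside $|\cdot|$ is nonzero), and the product converges to the left-hand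 side independently of the order of the factors. -/

import Mathlib

open scoped Quaternion

namespace QuatZeta

/-- The simplex part `a ∈ ℂ` in the symplectic decomposition `x = a + j b` of a quaternion:
for `x = x₀ + x₁ i + x₂ j + x₃ k` it is `a = x₀ + x₁ i`. -/
def simplex (x : ℍ[ℝ]) : ℂ := ⟨x.re, x.imI⟩

/-- The perplex part `b ∈ ℂ` in the symplectic decomposition `x = a + j b` of a quaternion:
for `x = x₀ + x₁ i + x₂ j + x₃ k` it is `b = x₂ - x₃ i`. -/
def perplex (x : ℍ[ℝ]) : ℂ := ⟨x.imJ, -x.imK⟩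

/-- The complex representation `ψ` of quaternionic matrices, in block form. -/
def psi {p q : Type*} (M : Matrix p q ℍ[ℝ]) : Matrix (p ⊕ p) (q ⊕ q) ℂ :=
  Matrix.fromBlocks (M.map simplex) (-((M.map perplex).map (starRingEnd ℂ)))
    (M.map perplex) ((M.map simplex).map (starRingEnd ℂ))

/-- The Study determinant of a square quaternionic matrix. -/
noncomputable def Sdet {p : Type*} [Fintype p] [DecidableEq p] (M : Matrix p p ℍ[ℝ]) : ℂ :=
  (psi M).det

section Graph

variable {V : Type*} [DecidableEq V] (G : SimpleGraph V)

/-- `W` is a quaternionic weighted matrix of `G`: its entries vanish off the arcs of `G`. -/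
def IsWeightedMatrix (W : Matrix V V ℍ[ℝ]) : Prop :=
  ∀ u v, ¬ G.Adj u v → W u v = 0

/-- The matrix `B_w`, indexed by the arcs of `G`: its `(e, f)`-entry is `w(f)` if the terminal
vertex of `e` is the origin of `f`, and `0` otherwise. -/
noncomputable def Bw (W : Matrix V V ℍ[ℝ]) : Matrix G.Dart G.Dart ℍ[ℝ] :=
  Matrix.of fun e f => if e.snd = f.fst then W f.fst f.snd else 0

/-- The matrix `J₀`, indexed by the arcs of `G`: its `(e, f)`-entry is `1` if `f` is the inverse
arc of `e`, and `0` otherwise. -/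
noncomputable def J0 : Matrix G.Dart G.Dart ℍ[ℝ] :=
  Matrix.of fun e f => if f = e.symm then 1 else 0

/-- `w̃(e, f)`, the `(e, f)`-entry of the `B`-weighted edge matrix `B_w - J₀`. -/
noncomputable def wTilde (W : Matrix V V ℍ[ℝ]) (e f : G.Dart) : ℍ[ℝ] := (Bw G W - J0 G) e f

/-- The quaternionic second weighted zeta function `Sdet(I - t (B_w - J₀))⁻¹`. -/
noncomputable def zeta [Fintype V] [DecidableRel G.Adj] (W : Matrix V V ℍ[ℝ]) (t : ℍ[ℝ]) : ℂ :=
  (Sdet (1 - t • (Bw G W - J0 G)))⁻¹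

end Graph

/-- Lyndon words over a totally ordered alphabet: nonempty words that are not a power `u ^ r` with
`r ≥ 2` of a word `u`, and are lexicographically minimal among their cyclic rearrangements. -/
def IsLyndon {α : Type*} [LinearOrder α] (w : List α) : Prop :=
  w ≠ [] ∧ (∀ (u : List α) (r : ℕ), 2 ≤ r → w ≠ (List.replicate r u).flatten) ∧
    ∀ w' : List α, w.IsRotated w' → w ≤ w'

/-- The cyclic product `a(i₁, i₂) a(i₂, i₃) ⋯ a(i_d, i₁)`, in this order, along the word
`i₁ i₂ ⋯ i_d`; for `d = 1` it is `a(i₁, i₁)`. -/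
noncomputable def cyclicProd {α : Type*} (a : α → α → ℍ[ℝ]) (w : List α) : ℍ[ℝ] :=
  (List.zipWith a w (w.rotate 1)).prod

end QuatZeta

/-! Take logarithms. With `M = t(B_w - J₀)`, `-log Sdet(1 - M)` is `∑ tr(ψ(M)^d)/d = ∑ 2 Re
tr(M^d)/d`, since `ψ` is multiplicative and its trace is twice the real trace
(`exists_hasSum_Sdet_one_sub`). Expanding traces gives the sum of `2 Re(cyclicProd w)/|w|` over all
nonempty words `w` (`hasSum_re_cyclicProd`), absolutely convergent because the entries are small.

Each nonempty word is uniquely a rotation of a power of a Lyndon word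
(`bijective_rotate_wordPow_lyndon`). Since `Re(xy) = Re(yx)`, the real part of the cyclic product is
rotation invariant, so the `|l|` rotations of `l^r` cancel the factor `1/|l|`. What remains for `l`
is `∑ 2 Re(x^r)/r = -log |1 - x|²`, with `x` its cyclic product: the same formula for a 1×1 matrix.
Exponentiating turns the unconditional sum into an unconditional product. -/

namespace QuatZeta

/-! ### Trace expansion of log det over ℂ -/

section Trace

open Polynomial Matrix

variable {n : Type*} [Fintype n] [DecidableEq n]

theorem det_sub_scalar_eq_prod_roots (A : Matrix n n ℂ) (a : ℂ) :
    (scalar n a - A).det = (A.charpoly.roots.map fun x => a - x).prod := by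
  rw [← Matrix.eval_charpoly,
    (IsAlgClosed.splits A.charpoly).eval_eq_prod_roots_of_monic A.charpoly_monic]

theorem card_roots_charpoly_complex (A : Matrix n n ℂ) :
    Multiset.card A.charpoly.roots = Fintype.card n := by
  rw [← (IsAlgClosed.splits A.charpoly).natDegree_eq_card_roots, charpoly_natDegree_eq_dim]

/-- Split `q` into linear factors; each contributes a value of the characteristic polynomial, up to
sign. -/
theorem det_aeval_eq_prod_roots_charpoly (A : Matrix n n ℂ) (q : ℂ[X]) :
    (aeval A q).det = (A.charpoly.roots.map fun x => q.eval x).prod := by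
  have key : ∀ s : Multiset ℂ, (aeval A (s.map fun a => X - C a).prod).det =
      (A.charpoly.roots.map fun x => ((s.map fun a => X - C a).prod).eval x).prod := by
    intro s
    induction s using Multiset.induction with
    | empty => simp
    | cons a s ih =>
      simp only [Multiset.map_cons, Multiset.prod_cons, map_mul, det_mul, ih, eval_mul,
        Multiset.prod_map_mul]
      congr 1
      have h : aeval A (X - C a) = -(scalar n a - A) := by
        simp [Matrix.algebraMap_eq_diagonal, scalar_apply]
      -- The sign `(-1)^n` is distributed over the `n` characteristic roots.
      rw [h, det_neg, det_sub_scalar_eq_prod_roots, ← card_roots_charpoly_complex A,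
        ← Multiset.card_map (fun x => a - x), ← Multiset.prod_map_neg]
      simp
  conv_lhs => rw [(IsAlgClosed.splits q).eq_prod_roots]
  conv_rhs => rw [(IsAlgClosed.splits q).eq_prod_roots]
  simp only [map_mul, aeval_C, eval_mul, eval_C, Multiset.prod_map_mul, det_mul, key]
  congr 1
  simp [← card_roots_charpoly_complex A, Matrix.algebraMap_eq_diagonal, det_diagonal]

/-- Spectral mapping with multiplicity: the previous determinant formula at `q = x - X^d` evaluates
the characteristic polynomial of `A ^ d` at `x`. -/
theorem trace_pow_eq_sum_roots_charpoly (A : Matrix n n ℂ) (d : ℕ) :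
    (A ^ d).trace = (A.charpoly.roots.map fun x => x ^ d).sum := by
  have h : (A ^ d).charpoly = ((A.charpoly.roots.map fun x => x ^ d).map fun a => X - C a).prod := by
    refine Polynomial.funext fun x => ?_
    have h1 := det_aeval_eq_prod_roots_charpoly A (C x - X ^ d)
    rw [Matrix.eval_charpoly, eval_multiset_prod]
    simp only [map_sub, map_pow, aeval_C, aeval_X, eval_sub, eval_C, eval_pow, eval_X] at h1
    simp only [Multiset.map_map, Function.comp_def, eval_sub, eval_X, eval_C]
    exact h1
  rw [trace_eq_sum_roots_charpoly, h, roots_multiset_prod_X_sub_C]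

/-- Gershgorin: an eigenvalue is bounded by some absolute row sum. -/
theorem norm_lt_one_of_mem_roots_charpoly {A : Matrix n n ℂ} {c : ℝ}
    (hA : ∀ i j, ‖A i j‖ ≤ c) (hc : Fintype.card n * c < 1) {x : ℂ} (hx : x ∈ A.charpoly.roots) :
    ‖x‖ < 1 := by
  have hx' : Module.End.HasEigenvalue (Matrix.toLin' A) x := by
    rw [Module.End.hasEigenvalue_iff_isRoot_charpoly]
    simpa using (mem_roots'.1 hx).2
  obtain ⟨k, hk⟩ := eigenvalue_mem_ball hx'
  rw [mem_closedBall_iff_norm] at hk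
  calc ‖x‖ ≤ ‖A k k‖ + ‖x - A k k‖ := norm_le_norm_add_norm_sub' x (A k k)
    _ ≤ ‖A k k‖ + ∑ j ∈ Finset.univ.erase k, ‖A k j‖ := by gcongr
    _ = ∑ j, ‖A k j‖ := Finset.add_sum_erase _ (fun j => ‖A k j‖) (Finset.mem_univ k)
    _ ≤ ∑ _j : n, c := Finset.sum_le_sum fun j _ => hA k j
    _ < 1 := by simpa using hc

/-- Stating the result through `exp (-S)` avoids choosing a branch for the logarithm of a product.
-/
theorem exists_hasSum_neg_log_prod (s : Multiset ℂ) (hs : ∀ x ∈ s, ‖x‖ < 1) :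
    ∃ S : ℂ, HasSum (fun d : ℕ => (s.map fun x => x ^ (d + 1)).sum / ((d : ℂ) + 1)) S ∧
      (s.map fun x => 1 - x).prod = Complex.exp (-S) := by
  induction s using Multiset.induction with
  | empty => exact ⟨0, by simp, by simp⟩
  | cons a s ih =>
    obtain ⟨S, hS, hp⟩ := ih fun x hx => hs x (Multiset.mem_cons_of_mem hx)
    have ha := hs a (Multiset.mem_cons_self a s)
    have h1 := (hasSum_nat_add_iff' 1).2 (Complex.hasSum_taylorSeries_neg_log ha)
    have hne : 1 - a ≠ 0 := by
      intro h
      rw [← sub_eq_zero.1 h] at ha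
      simp at ha
    refine ⟨_, (h1.add hS).congr_fun fun d => ?_, ?_⟩
    · simp [add_div]
    · simp [hp, Complex.exp_add, Complex.exp_log hne, mul_comm]

theorem exists_hasSum_trace_pow {A : Matrix n n ℂ} {c : ℝ}
    (hA : ∀ i j, ‖A i j‖ ≤ c) (hc : Fintype.card n * c < 1) :
    ∃ S : ℂ, HasSum (fun d : ℕ => (A ^ (d + 1)).trace / ((d : ℂ) + 1)) S ∧
      (1 - A).det = Complex.exp (-S) := by
  obtain ⟨S, hS, hp⟩ := exists_hasSum_neg_log_prod A.charpoly.roots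
    fun x hx => norm_lt_one_of_mem_roots_charpoly hA hc hx
  refine ⟨S, by simpa only [trace_pow_eq_sum_roots_charpoly] using hS, ?_⟩
  rw [← hp, ← det_sub_scalar_eq_prod_roots, map_one]

end Trace

/-! ### Complex representation and Study determinant -/

section Psi

variable {p q r : Type*}

theorem simplex_add (x y : ℍ[ℝ]) : simplex (x + y) = simplex x + simplex y := by
  apply Complex.ext <;> simp [simplex]

theorem perplex_add (x y : ℍ[ℝ]) : perplex (x + y) = perplex x + perplex y := by
  apply Complex.ext <;> simp [perplex]
  ring

theorem simplex_sum {ι : Type*} (s : Finset ι) (f : ι → ℍ[ℝ]) :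
    simplex (∑ i ∈ s, f i) = ∑ i ∈ s, simplex (f i) :=
  map_sum (AddMonoidHom.mk' simplex simplex_add) f s

theorem perplex_sum {ι : Type*} (s : Finset ι) (f : ι → ℍ[ℝ]) :
    perplex (∑ i ∈ s, f i) = ∑ i ∈ s, perplex (f i) :=
  map_sum (AddMonoidHom.mk' perplex perplex_add) f s

theorem simplex_mul (x y : ℍ[ℝ]) :
    simplex (x * y) = simplex x * simplex y - starRingEnd ℂ (perplex x) * perplex y := by
  apply Complex.ext <;> simp [simplex, perplex] <;> ring

theorem perplex_mul (x y : ℍ[ℝ]) :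
    perplex (x * y) = perplex x * simplex y + starRingEnd ℂ (simplex x) * perplex y := by
  apply Complex.ext <;> simp [simplex, perplex] <;> ring

theorem norm_simplex_le (x : ℍ[ℝ]) : ‖simplex x‖ ≤ ‖x‖ := by
  rw [← sq_le_sq₀ (norm_nonneg _) (norm_nonneg _), Complex.sq_norm, Complex.normSq_apply, sq ‖x‖,
    ← Quaternion.normSq_eq_norm_mul_self, Quaternion.normSq_def']
  simp only [simplex]
  nlinarith [sq_nonneg x.imJ, sq_nonneg x.imK]

theorem norm_perplex_le (x : ℍ[ℝ]) : ‖perplex x‖ ≤ ‖x‖ := by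
  rw [← sq_le_sq₀ (norm_nonneg _) (norm_nonneg _), Complex.sq_norm, Complex.normSq_apply, sq ‖x‖,
    ← Quaternion.normSq_eq_norm_mul_self, Quaternion.normSq_def']
  simp only [perplex]
  nlinarith [sq_nonneg x.re, sq_nonneg x.imI]

theorem psi_sub (M N : Matrix p q ℍ[ℝ]) : psi (M - N) = psi M - psi N := by
  ext (i | i) (j | j) <;> apply Complex.ext <;> simp [psi, simplex, perplex] <;> ring

theorem psi_one [DecidableEq p] : psi (1 : Matrix p p ℍ[ℝ]) = 1 := by
  ext (i | i) (j | j) <;> by_cases h : i = j <;> apply Complex.ext <;>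
    simp [psi, simplex, perplex, Matrix.one_apply, h]

theorem psi_mul [Fintype q] (M : Matrix p q ℍ[ℝ]) (N : Matrix q r ℍ[ℝ]) :
    psi (M * N) = psi M * psi N := by
  ext (i | i) (j | j) <;>
    simp [psi, Matrix.mul_apply, simplex_sum, perplex_sum, simplex_mul, perplex_mul,
      Finset.sum_add_distrib, Finset.sum_neg_distrib, Finset.sum_sub_distrib] <;> ring

theorem psi_pow [Fintype p] [DecidableEq p] (M : Matrix p p ℍ[ℝ]) (d : ℕ) :
    psi (M ^ d) = psi M ^ d := by
  induction d with
  | zero => simp [psi_one]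
  | succ d ih => rw [pow_succ, pow_succ, psi_mul, ih]

theorem trace_psi [Fintype p] (M : Matrix p p ℍ[ℝ]) :
    (psi M).trace = ((2 * M.trace.re : ℝ) : ℂ) := by
  have h : M.trace.re = ∑ i, (M i i).re :=
    map_sum (AddMonoidHom.mk' (fun x : ℍ[ℝ] => x.re) fun _ _ => rfl) _ _
  rw [h]
  apply Complex.ext <;>
    simp [psi, Matrix.trace, simplex, two_mul]

theorem norm_psi_apply_le {M : Matrix p q ℍ[ℝ]} {c : ℝ} (h : ∀ i j, ‖M i j‖ ≤ c) (i : p ⊕ p)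
    (j : q ⊕ q) : ‖psi M i j‖ ≤ c := by
  rcases i with i | i <;> rcases j with j | j <;> simp [psi] <;>
    first
      | exact (norm_simplex_le _).trans (h i j)
      | exact (norm_perplex_le _).trans (h i j)

theorem Sdet_submatrix_equiv [Fintype p] [DecidableEq p] [Fintype q] [DecidableEq q] (e : p ≃ q)
    (M : Matrix q q ℍ[ℝ]) : Sdet (M.submatrix e e) = Sdet M := by
  have h : psi (M.submatrix e e) =
      (psi M).submatrix (Equiv.sumCongr e e) (Equiv.sumCongr e e) := by
    ext (i | i) (j | j) <;> rfl
  rw [Sdet, h, Matrix.det_submatrix_equiv_self, Sdet]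

/-- The logarithm of the Study determinant of `1 - M`, for a matrix with small entries. -/
theorem exists_hasSum_Sdet_one_sub [Fintype p] [DecidableEq p] {M : Matrix p p ℍ[ℝ]} {c : ℝ}
    (hM : ∀ i j, ‖M i j‖ ≤ c) (hc : 2 * (Fintype.card p * c) < 1) :
    ∃ S : ℝ, HasSum (fun d : ℕ => 2 * (M ^ (d + 1)).trace.re / ((d : ℝ) + 1)) S ∧
      Sdet (1 - M) = ((Real.exp (-S) : ℝ) : ℂ) := by
  obtain ⟨S, hS, hp⟩ := exists_hasSum_trace_pow (norm_psi_apply_le hM)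
    (by rw [Fintype.card_sum]; push_cast; linarith)
  have h : ∀ d : ℕ, (psi M ^ (d + 1)).trace / ((d : ℂ) + 1) =
      ((2 * (M ^ (d + 1)).trace.re / ((d : ℝ) + 1) : ℝ) : ℂ) := by
    intro d
    rw [← psi_pow, trace_psi]
    push_cast
    rfl
  simp only [h] at hS
  have hre : HasSum (fun d : ℕ => 2 * (M ^ (d + 1)).trace.re / ((d : ℝ) + 1)) S.re :=
    Complex.hasSum_re hS
  refine ⟨S.re, hre, ?_⟩
  rw [Sdet, psi_sub, psi_one, hp, hS.unique (Complex.hasSum_ofReal.2 hre)]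
  push_cast
  simp

/-- The 2×2 determinant is `|a|² + |b|²` for `1 - x = a + jb`. This lets the matrix formula supply
the logarithm of a single Euler factor. -/
theorem Sdet_one_sub_of_unit (x : ℍ[ℝ]) :
    Sdet (1 - Matrix.of fun _ _ : Unit => x) = ((‖1 - x‖ ^ 2 : ℝ) : ℂ) := by
  have h : psi (1 - Matrix.of fun _ _ : Unit => x) = Matrix.fromBlocks
      (Matrix.of fun _ _ => simplex (1 - x))
      (Matrix.of fun _ _ => -starRingEnd ℂ (perplex (1 - x)))
      (Matrix.of fun _ _ => perplex (1 - x))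
      (Matrix.of fun _ _ => starRingEnd ℂ (simplex (1 - x))) := by
    ext (i | i) (j | j) <;> rfl
  rw [Sdet, h]
  have h2 := Matrix.det_submatrix_equiv_self (Equiv.boolEquivPUnitSumPUnit.{0, 0})
    (Matrix.fromBlocks
      (Matrix.of fun _ _ : Unit => simplex (1 - x))
      (Matrix.of fun _ _ : Unit => -starRingEnd ℂ (perplex (1 - x)))
      (Matrix.of fun _ _ : Unit => perplex (1 - x))
      (Matrix.of fun _ _ : Unit => starRingEnd ℂ (simplex (1 - x))))
  rw [← h2, ← Matrix.det_submatrix_equiv_self finTwoEquiv, Matrix.det_fin_two, sq ‖1 - x‖,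
    ← Quaternion.normSq_eq_norm_mul_self, Quaternion.normSq_def']
  have e0 : Equiv.boolEquivPUnitSumPUnit.{0, 0} (finTwoEquiv 0) = Sum.inl PUnit.unit := rfl
  have e1 : Equiv.boolEquivPUnitSumPUnit.{0, 0} (finTwoEquiv 1) = Sum.inr PUnit.unit := rfl
  generalize 1 - x = y
  simp only [Matrix.submatrix_apply, e0, e1, Matrix.fromBlocks_apply₁₁, Matrix.fromBlocks_apply₁₂,
    Matrix.fromBlocks_apply₂₁, Matrix.fromBlocks_apply₂₂, Matrix.of_apply]
  apply Complex.ext <;> simp [simplex, perplex, -Complex.ofReal_pow, -Complex.ofReal_add] <;> ring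

end Psi

end QuatZeta

namespace QuatZeta

/-! ### Combinatorics of primitive and Lyndon words -/

section Words

variable {α : Type*}

/-- The power `u ^ r` of a word. -/
def wordPow (u : List α) (r : ℕ) : List α := (List.replicate r u).flatten

/-- Nonempty words that are not a proper power. -/
def IsPrimitiveWord (u : List α) : Prop :=
  u ≠ [] ∧ ∀ (v : List α) (r : ℕ), 2 ≤ r → u ≠ wordPow v r

theorem wordPow_zero (u : List α) : wordPow u 0 = [] := by simp [wordPow]

theorem wordPow_succ (u : List α) (r : ℕ) : wordPow u (r + 1) = u ++ wordPow u r := by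
  simp [wordPow, List.replicate_succ]

theorem wordPow_one (u : List α) : wordPow u 1 = u := by simp [wordPow]

theorem nil_wordPow (r : ℕ) : wordPow ([] : List α) r = [] := by simp [wordPow]

theorem length_wordPow (u : List α) (r : ℕ) : (wordPow u r).length = r * u.length := by
  simp [wordPow]

theorem wordPow_add (u : List α) (r s : ℕ) : wordPow u (r + s) = wordPow u r ++ wordPow u s := by
  rw [wordPow, ← List.replicate_append_replicate, List.flatten_append]; rfl

theorem wordPow_wordPow (u : List α) (r s : ℕ) : wordPow (wordPow u r) s = wordPow u (s * r) := by
  induction s with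
  | zero => simp [wordPow_zero]
  | succ s ih => rw [wordPow_succ, ih, ← wordPow_add, Nat.succ_mul, add_comm]

theorem append_wordPow_append (x y : List α) (r : ℕ) :
    x ++ wordPow (y ++ x) r = wordPow (x ++ y) r ++ x := by
  induction r with
  | zero => simp [wordPow_zero]
  | succ r ih => rw [wordPow_succ, wordPow_succ, List.append_assoc (x ++ y), ← ih]; simp

theorem wordPow_rotate_one (u : List α) (r : ℕ) :
    (wordPow u r).rotate 1 = wordPow (u.rotate 1) r := by
  rcases u with _ | ⟨x, u⟩
  · simp [nil_wordPow]
  · cases r with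
    | zero => simp [wordPow_zero]
    | succ r =>
      rw [wordPow_succ, wordPow_succ, List.cons_append, List.rotate_cons_succ, List.rotate_zero,
        List.rotate_cons_succ, List.rotate_zero, List.append_assoc, List.append_assoc,
        append_wordPow_append]
      rfl

theorem wordPow_rotate (u : List α) (r k : ℕ) :
    (wordPow u r).rotate k = wordPow (u.rotate k) r := by
  induction k with
  | zero => simp
  | succ k ih => rw [← List.rotate_rotate, ih, wordPow_rotate_one, List.rotate_rotate]

theorem wordPow_succ_injective (r : ℕ) :
    Function.Injective fun u : List α => wordPow u (r + 1) := by
  intro u v h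
  have hl := congrArg List.length h
  simp only [length_wordPow] at hl
  simp only [wordPow_succ] at h
  exact (List.append_inj h (Nat.eq_of_mul_eq_mul_left (Nat.succ_pos r) hl)).1

theorem eq_wordPow_of_append_comm {x : List α} (q : ℕ) :
    ∀ {y : List α}, x ++ y = y ++ x → y.length = q * x.length → y = wordPow x q := by
  induction q with
  | zero =>
    intro y _ hl
    rw [wordPow_zero]
    simpa using hl
  | succ q ih =>
    intro y h hl
    have hle : x.length ≤ y.length := by rw [hl]; nlinarith
    obtain ⟨z, rfl⟩ : x <+: y :=
      List.prefix_of_prefix_length_le (List.prefix_append x y) (h ▸ List.prefix_append y x) hle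
    rw [List.append_assoc, List.append_cancel_left_eq] at h
    rw [wordPow_succ, ← ih h]
    rw [List.length_append, Nat.succ_mul] at hl
    omega

theorem iterate_rotate_one (k : ℕ) (u : List α) : (fun l => List.rotate l 1)^[k] u = u.rotate k := by
  induction k with
  | zero => simp
  | succ k ih => rw [Function.iterate_succ_apply', ih, List.rotate_rotate]

theorem rotate_gcd_eq_self {u : List α} {k l : ℕ} (hk : u.rotate k = u) (hl : u.rotate l = u) :
    u.rotate (k.gcd l) = u := by
  rw [← iterate_rotate_one] at hk hl ⊢
  exact Function.IsPeriodicPt.gcd hk hl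

/-- Rotation periods are closed under gcd, and a period properly dividing the length would make `u`
a power of a prefix. -/
theorem IsPrimitiveWord.length_dvd {u : List α} (hu : IsPrimitiveWord u) {k : ℕ}
    (hk : u.rotate k = u) : u.length ∣ k := by
  have hpos : 0 < u.length := List.length_pos_iff.2 hu.1
  have hg := rotate_gcd_eq_self hk u.rotate_length
  set g := k.gcd u.length with hgdef
  have hgk : g ∣ k := Nat.gcd_dvd_left _ _
  obtain ⟨q, hq⟩ : g ∣ u.length := Nat.gcd_dvd_right _ _
  have hgle : g ≤ u.length := Nat.gcd_le_right _ hpos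
  rcases q with _ | _ | q
  · omega
  · rwa [hq, zero_add, mul_one]
  · exfalso
    rw [List.rotate_eq_drop_append_take hgle] at hg
    have hlen : (u.take g).length = g := by simp [hgle]
    have h := eq_wordPow_of_append_comm (x := u.take g) (q + 1) (y := u.drop g)
      (by rw [hg, List.take_append_drop])
      (by rw [hlen, List.length_drop, hq]; rw [Nat.mul_comm g]; simp [Nat.succ_mul])
    refine hu.2 (u.take g) (q + 2) (by omega) ?_
    rw [wordPow_succ, ← h, List.take_append_drop]

/-- Rotation by `|v|` fixes the common power, hence fixes `u`, so `|u|` divides `|v|`; the converse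
is symmetric. -/
theorem IsPrimitiveWord.eq_of_wordPow_eq {u v : List α} (hu : IsPrimitiveWord u)
    (hv : IsPrimitiveWord v) {r s : ℕ} (h : wordPow u (r + 1) = wordPow v (s + 1)) :
    u = v ∧ r = s := by
  have h1 : u.length ∣ v.length := hu.length_dvd <| wordPow_succ_injective r <| by
    simp only
    rw [← wordPow_rotate, h, wordPow_rotate, List.rotate_length]
  have h2 : v.length ∣ u.length := hv.length_dvd <| wordPow_succ_injective s <| by
    simp only
    rw [← wordPow_rotate, ← h, wordPow_rotate, List.rotate_length]
  have hl := Nat.dvd_antisymm h1 h2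
  have hrs := congrArg List.length h
  rw [length_wordPow, length_wordPow, hl] at hrs
  have hpos : 0 < v.length := List.length_pos_iff.2 hv.1
  obtain rfl : r = s := by simpa using Nat.eq_of_mul_eq_mul_right hpos hrs
  exact ⟨wordPow_succ_injective r h, rfl⟩

theorem IsPrimitiveWord.of_isRotated {u v : List α} (hu : IsPrimitiveWord u) (h : v.IsRotated u) :
    IsPrimitiveWord v := by
  obtain ⟨k, rfl⟩ := h
  refine ⟨fun h => hu.1 (by simp [h]), fun w r hr h => hu.2 (w.rotate k) r hr ?_⟩
  rw [h, wordPow_rotate]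

theorem exists_isPrimitiveWord_wordPow_eq {w : List α} (hw : w ≠ []) :
    ∃ u r, IsPrimitiveWord u ∧ wordPow u (r + 1) = w := by
  induction hn : w.length using Nat.strong_induction_on generalizing w with
  | _ n ih =>
    by_cases hp : IsPrimitiveWord w
    · exact ⟨w, 0, hp, wordPow_one w⟩
    · obtain ⟨v, s, hs, rfl⟩ : ∃ v s, 2 ≤ s ∧ w = wordPow v s := by
        by_contra! hcon
        exact hp ⟨hw, hcon⟩
      have hv : v ≠ [] := fun h => hw (by rw [h, nil_wordPow])
      have hpos : 0 < v.length := List.length_pos_iff.2 hv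
      obtain ⟨u, r, hu, rfl⟩ := ih v.length (by rw [← hn, length_wordPow]; nlinarith) hv rfl
      refine ⟨u, s * (r + 1) - 1, hu, ?_⟩
      rw [wordPow_wordPow, Nat.sub_add_cancel (by nlinarith)]

variable [LinearOrder α]

theorem IsLyndon.isPrimitiveWord {l : List α} (hl : IsLyndon l) : IsPrimitiveWord l :=
  ⟨hl.1, hl.2.1⟩

theorem IsLyndon.eq_of_isRotated {l l' : List α} (hl : IsLyndon l) (hl' : IsLyndon l')
    (h : l.IsRotated l') : l = l' :=
  le_antisymm (hl.2.2 l' h) (hl'.2.2 l h.symm)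

theorem IsPrimitiveWord.exists_isLyndon {u : List α} (hu : IsPrimitiveWord u) :
    ∃ l : List α, IsLyndon l ∧ ∃ k < l.length, l.rotate k = u := by
  have hpos : 0 < u.length := List.length_pos_iff.2 hu.1
  obtain ⟨k, -, hk⟩ := Finset.exists_min_image (Finset.range u.length) (fun k => u.rotate k)
    ⟨0, Finset.mem_range.2 hpos⟩
  have hrot : (u.rotate k).IsRotated u := List.IsRotated.forall u k
  refine ⟨u.rotate k, ⟨(hu.of_isRotated hrot).1, (hu.of_isRotated hrot).2, ?_⟩, ?_⟩
  · rintro _ ⟨j, rfl⟩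
    rw [List.rotate_rotate, ← List.rotate_mod u (k + j)]
    exact hk _ (Finset.mem_range.2 (Nat.mod_lt _ hpos))
  · obtain ⟨j, hj⟩ := hrot
    refine ⟨j % (u.rotate k).length, Nat.mod_lt _ (by simpa using hpos), ?_⟩
    rw [List.rotate_mod, hj]

/-- Every nonempty word is, in exactly one way, a rotation of a power of a Lyndon word. -/
theorem bijective_rotate_wordPow_lyndon : Function.Bijective
    (fun x : (Σ l : {l : List α // IsLyndon l}, Σ _ : ℕ, Fin l.1.length) =>
      (⟨(wordPow x.1.1 (x.2.1 + 1)).rotate x.2.2, by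
        rw [Ne, List.rotate_eq_nil_iff, wordPow_succ]
        simp [x.1.2.1]⟩ : {w : List α // w ≠ []})) := by
  constructor
  · rintro ⟨⟨l, hl⟩, r, k⟩ ⟨⟨l', hl'⟩, r', k'⟩ h
    simp only [Subtype.mk.injEq, wordPow_rotate] at h
    obtain ⟨h1, rfl⟩ := IsPrimitiveWord.eq_of_wordPow_eq
      (hl.isPrimitiveWord.of_isRotated (List.IsRotated.forall l k))
      (hl'.isPrimitiveWord.of_isRotated (List.IsRotated.forall l' k')) h
    obtain rfl : l = l' := hl.eq_of_isRotated hl' <|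
      (List.IsRotated.forall l k).symm.trans (h1 ▸ List.IsRotated.forall l' k')
    -- The offset `j - i` is a period of a primitive word, smaller than its length, hence zero.
    have key : ∀ i j : Fin l.length, i ≤ j → l.rotate i = l.rotate j → i = j := by
      intro i j hij h2
      have h3 : l.rotate (j - i : ℕ) = l := by
        have h4 : (l.rotate (j - i : ℕ)).rotate i = l.rotate i := by
          rw [List.rotate_rotate, Nat.sub_add_cancel hij, h2]
        exact List.rotate_eq_rotate.1 h4
      have h5 := Nat.eq_zero_of_dvd_of_lt (hl.isPrimitiveWord.length_dvd h3) (by omega)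
      ext
      have : (i : ℕ) ≤ j := hij
      omega
    obtain rfl : k = k' := (le_total k k').elim (fun hkk => key k k' hkk h1)
      fun hkk => (key k' k hkk h1.symm).symm
    rfl
  · rintro ⟨w, hw⟩
    obtain ⟨u, r, hu, rfl⟩ := exists_isPrimitiveWord_wordPow_eq hw
    obtain ⟨l, hl, k, hk, rfl⟩ := hu.exists_isLyndon
    exact ⟨⟨⟨l, hl⟩, r, ⟨k, hk⟩⟩, Subtype.ext (wordPow_rotate l (r + 1) k)⟩

end Words

end QuatZeta

namespace QuatZeta

/-! ### Cyclic products, summation over words, Euler product -/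

section CyclicProd

variable {α : Type*}

theorem re_prod_rotate (l : List ℍ[ℝ]) (k : ℕ) : (l.rotate k).prod.re = l.prod.re := by
  rw [← List.rotate_mod]
  rcases eq_or_ne l [] with rfl | hl
  · simp
  · rw [List.rotate_eq_drop_append_take (Nat.mod_lt _ (List.length_pos_iff.2 hl)).le]
    conv_rhs => rw [← List.take_append_drop (k % l.length) l]
    rw [List.prod_append, List.prod_append]
    simp only [Quaternion.re_mul]
    ring

theorem re_cyclicProd_rotate (a : α → α → ℍ[ℝ]) (w : List α) (k : ℕ) :
    (cyclicProd a (w.rotate k)).re = (cyclicProd a w).re := by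
  rw [cyclicProd, List.rotate_rotate, add_comm, ← List.rotate_rotate,
    ← List.zipWith_rotate_distrib a w (w.rotate 1) k (by simp), re_prod_rotate, cyclicProd]

theorem cyclicProd_wordPow (a : α → α → ℍ[ℝ]) (w : List α) (r : ℕ) :
    cyclicProd a (wordPow w r) = cyclicProd a w ^ r := by
  rw [cyclicProd, wordPow_rotate, cyclicProd]
  induction r with
  | zero => simp [wordPow_zero]
  | succ r ih =>
    rw [wordPow_succ, wordPow_succ, List.zipWith_append (by simp), List.prod_append, ih, pow_succ']

theorem norm_prod_zipWith_le {a : α → α → ℍ[ℝ]} {c : ℝ} (hc : 0 ≤ c) (ha : ∀ i j, ‖a i j‖ ≤ c)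
    (l l' : List α) (h : l.length = l'.length) :
    ‖(List.zipWith a l l').prod‖ ≤ c ^ l.length := by
  induction l generalizing l' with
  | nil => simp
  | cons x l ih =>
    rcases l' with _ | ⟨y, l'⟩
    · simp at h
    · rw [List.zipWith_cons_cons, List.prod_cons, norm_mul, List.length_cons, pow_succ']
      exact mul_le_mul (ha x y) (ih l' (by simpa using h)) (norm_nonneg _) hc

theorem norm_cyclicProd_le {a : α → α → ℍ[ℝ]} {c : ℝ} (hc : 0 ≤ c) (ha : ∀ i j, ‖a i j‖ ≤ c)
    (w : List α) : ‖cyclicProd a w‖ ≤ c ^ w.length :=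
  norm_prod_zipWith_le hc ha _ _ (by simp)

variable [Fintype α]

/-- Here `w` lists the `d` intermediate vertices of a path from `i` to `j`. -/
theorem matrix_pow_succ_apply [DecidableEq α] (a : α → α → ℍ[ℝ]) (d : ℕ) (i j : α) :
    (Matrix.of a ^ (d + 1)) i j =
      ∑ w : Fin d → α, (List.zipWith a (i :: List.ofFn w) (List.ofFn w ++ [j])).prod := by
  induction d generalizing i with
  | zero => simp
  | succ d ih =>
    rw [pow_succ', Matrix.mul_apply, ← (Fin.consEquiv fun _ => α).sum_comp, Fintype.sum_prod_type]
    refine Finset.sum_congr rfl fun k _ => ?_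
    rw [ih, Finset.mul_sum]
    refine Finset.sum_congr rfl fun w _ => ?_
    simp [Fin.consEquiv]

theorem trace_matrix_pow_succ [DecidableEq α] (a : α → α → ℍ[ℝ]) (d : ℕ) :
    (Matrix.of a ^ (d + 1)).trace = ∑ w : Fin (d + 1) → α, cyclicProd a (List.ofFn w) := by
  rw [← (Fin.consEquiv fun _ => α).sum_comp, Fintype.sum_prod_type, Matrix.trace]
  refine Finset.sum_congr rfl fun i _ => ?_
  rw [Matrix.diag_apply, matrix_pow_succ_apply]
  refine Finset.sum_congr rfl fun w _ => ?_
  simp [Fin.consEquiv, cyclicProd]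

/-- Grouping words by length gives a geometric series of ratio `|α| c`. -/
theorem summable_pow_length {c : ℝ} (hc : 0 ≤ c) (hn : Fintype.card α * c < 1) :
    Summable fun w : List α => c ^ w.length := by
  rw [← (List.equivSigmaTuple (α := α)).symm.summable_iff]
  refine (summable_sigma_of_nonneg fun _ => pow_nonneg hc _).2 ?_
  refine ⟨fun d => Summable.of_finite, ?_⟩
  have h : ∀ d : ℕ, (∑' w : Fin d → α,
      ((fun w : List α => c ^ w.length) ∘ (List.equivSigmaTuple (α := α)).symm) ⟨d, w⟩) =
        (Fintype.card α * c) ^ d := by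
    intro d
    rw [tsum_fintype]
    simp [List.equivSigmaTuple, mul_pow]
  exact (summable_geometric_of_lt_one (by positivity) hn).congr fun d => (h d).symm

theorem summable_re_cyclicProd {a : α → α → ℍ[ℝ]} {c : ℝ} (hc : 0 ≤ c)
    (ha : ∀ i j, ‖a i j‖ ≤ c) (hn : Fintype.card α * c < 1) :
    Summable fun w : List α => 2 * (cyclicProd a w).re / w.length := by
  refine Summable.of_norm_bounded ((summable_pow_length hc hn).mul_left 2) fun w => ?_
  have h1 : |(cyclicProd a w).re| ≤ c ^ w.length := by
    refine le_trans ?_ (norm_cyclicProd_le hc ha w)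
    rw [← sq_le_sq₀ (abs_nonneg _) (norm_nonneg _), sq_abs, sq ‖_‖,
      ← Quaternion.normSq_eq_norm_mul_self, Quaternion.normSq_def']
    nlinarith [sq_nonneg (cyclicProd a w).imI, sq_nonneg (cyclicProd a w).imJ,
      sq_nonneg (cyclicProd a w).imK]
  rw [norm_div, norm_mul, Real.norm_eq_abs, Real.norm_eq_abs, Real.norm_eq_abs, abs_two,
    Nat.abs_cast]
  rcases w.length.eq_zero_or_pos with h0 | hpos
  · rw [h0]; simp
  · have : (1 : ℝ) ≤ w.length := by exact_mod_cast hpos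
    refine (div_le_self (by positivity) this).trans ?_
    gcongr

/-- The Amitsur identity in logarithmic form. -/
theorem hasSum_re_cyclicProd [DecidableEq α] {a : α → α → ℍ[ℝ]} {c : ℝ} (hc : 0 ≤ c)
    (ha : ∀ i j, ‖a i j‖ ≤ c) (hn : Fintype.card α * c < 1) {S : ℝ}
    (hS : HasSum (fun d : ℕ => 2 * (Matrix.of a ^ (d + 1)).trace.re / ((d : ℝ) + 1)) S) :
    HasSum (fun w : {w : List α // w ≠ []} => 2 * (cyclicProd a w.1).re / w.1.length) S := by
  have hsum := (summable_re_cyclicProd hc ha hn).hasSum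
  have h1 := (List.equivSigmaTuple (α := α)).symm.hasSum_iff.2 hsum
  have h2 := h1.sigma fun d => hasSum_fintype _
  rw [← hasSum_nat_add_iff' 1] at h2
  have h3 : ∀ d : ℕ, (∑ w : Fin (d + 1) → α,
      ((fun w : List α => 2 * (cyclicProd a w).re / w.length) ∘
        (List.equivSigmaTuple (α := α)).symm) ⟨d + 1, w⟩) =
        2 * (Matrix.of a ^ (d + 1)).trace.re / ((d : ℝ) + 1) := by
    intro d
    have hre : (∑ w : Fin (d + 1) → α, cyclicProd a (List.ofFn w)).re =
        ∑ w : Fin (d + 1) → α, (cyclicProd a (List.ofFn w)).re :=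
      map_sum (AddMonoidHom.mk' (fun x : ℍ[ℝ] => x.re) fun _ _ => rfl) _ _
    rw [trace_matrix_pow_succ, hre, Finset.mul_sum, Finset.sum_div]
    simp [List.equivSigmaTuple]
  simp only [h3] at h2
  have h4 := h2.unique hS
  -- The empty word contributes nothing: its term is a division by zero.
  simp [List.equivSigmaTuple] at h4
  rw [h4] at hsum
  exact (hasSum_subtype_iff_of_support_subset (s := {w : List α | w ≠ []}) (by
    intro w hw h
    simp [h] at hw)).2 hsum

theorem hasProd_lyndon [DecidableEq α] [LinearOrder α] {a : α → α → ℍ[ℝ]} {c : ℝ} (hc : 0 ≤ c)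
    (ha : ∀ i j, ‖a i j‖ ≤ c) (hn : 2 * (Fintype.card α * c) < 1) :
    Sdet (1 - Matrix.of a) ≠ 0 ∧ (∀ l : List α, IsLyndon l → 1 - cyclicProd a l ≠ 0) ∧
    HasProd (fun l : {l : List α // IsLyndon l} =>
      ((‖1 - cyclicProd a l.1‖ ^ (-2 : ℤ) : ℝ) : ℂ)) (Sdet (1 - Matrix.of a))⁻¹ := by
  obtain ⟨S, hS, hdet⟩ := exists_hasSum_Sdet_one_sub (M := Matrix.of a) ha hn
  have hcard : 0 ≤ Fintype.card α * c := by positivity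
  have hloc : ∀ l : {l : List α // IsLyndon l}, ∃ s : ℝ,
      HasSum (fun r : ℕ => 2 * (cyclicProd a l.1 ^ (r + 1)).re / ((r : ℝ) + 1)) s ∧
      ‖1 - cyclicProd a l.1‖ ^ 2 = Real.exp (-s) := by
    rintro ⟨l, hl⟩
    obtain ⟨x, l', rfl⟩ := List.exists_cons_of_ne_nil hl.1
    have : Nonempty α := ⟨x⟩
    have h1 : (1 : ℝ) ≤ Fintype.card α := by exact_mod_cast Fintype.card_pos
    -- The smallness condition for a 1×1 matrix, available since the alphabet is nonempty.
    have hc1 : 2 * c < 1 := by nlinarith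
    have hb : ‖cyclicProd a (x :: l')‖ ≤ c := by
      refine (norm_cyclicProd_le hc ha _).trans ?_
      rw [List.length_cons, pow_succ]
      exact mul_le_of_le_one_left hc (pow_le_one₀ hc (by linarith))
    obtain ⟨s, hs, he⟩ := exists_hasSum_Sdet_one_sub
      (M := Matrix.of fun _ _ : Unit => cyclicProd a (x :: l')) (c := c) (fun _ _ => hb)
      (by simpa using hc1)
    rw [Sdet_one_sub_of_unit] at he
    refine ⟨s, ?_, by exact_mod_cast he⟩
    have hpow : ∀ r : ℕ, (Matrix.of fun _ _ : Unit => cyclicProd a (x :: l')) ^ r =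
        Matrix.of fun _ _ : Unit => cyclicProd a (x :: l') ^ r := by
      intro r
      induction r with
      | zero => ext1 i j; simp
      | succ r ih => rw [pow_succ, ih]; ext1 i j; simp [Matrix.mul_apply, pow_succ]
    simpa only [hpow, Matrix.trace, Matrix.diag_apply, Matrix.of_apply, Finset.univ_unique,
      Finset.sum_singleton] using hs
  choose s hs hexp using hloc
  refine ⟨by simp [hdet], fun l hl h => ?_, ?_⟩
  · have := hexp ⟨l, hl⟩
    simp [h] at this
    exact (Real.exp_pos _).ne this
  have hwords := hasSum_re_cyclicProd hc ha (by linarith) hS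
  have hE := (Equiv.ofBijective _ (bijective_rotate_wordPow_lyndon (α := α))).hasSum_iff.2 hwords
  have hterm : ∀ (l : {l : List α // IsLyndon l}) (r : ℕ) (k : Fin l.1.length),
      ((fun w : {w : List α // w ≠ []} => 2 * (cyclicProd a w.1).re / w.1.length) ∘
        (Equiv.ofBijective _ (bijective_rotate_wordPow_lyndon (α := α)))) ⟨l, r, k⟩ =
      2 * (cyclicProd a l.1 ^ (r + 1)).re / (((r : ℝ) + 1) * l.1.length) := by
    intro l r k
    simp [re_cyclicProd_rotate, cyclicProd_wordPow, length_wordPow]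
  -- For each `r`, summing over the `|l|` rotations cancels `|l|` in the denominator and leaves the
  -- logarithmic series of one factor.
  have hfib : ∀ l : {l : List α // IsLyndon l},
      HasSum (fun x : (Σ _ : ℕ, Fin l.1.length) =>
        ((fun w : {w : List α // w ≠ []} => 2 * (cyclicProd a w.1).re / w.1.length) ∘
          (Equiv.ofBijective _ (bijective_rotate_wordPow_lyndon (α := α)))) ⟨l, x⟩) (s l) := by
    intro l
    have h1 := (hE.summable.sigma_factor l).hasSum
    have h2 := h1.sigma fun r => hasSum_fintype _
    have hl : (l.1.length : ℝ) ≠ 0 := by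
      exact_mod_cast (List.length_pos_iff.2 l.2.1).ne'
    have h3 : ∀ r : ℕ, (∑ k : Fin l.1.length,
        ((fun w : {w : List α // w ≠ []} => 2 * (cyclicProd a w.1).re / w.1.length) ∘
          (Equiv.ofBijective _ (bijective_rotate_wordPow_lyndon (α := α)))) ⟨l, r, k⟩) =
        2 * (cyclicProd a l.1 ^ (r + 1)).re / ((r : ℝ) + 1) := by
      intro r
      simp only [hterm, Finset.sum_const, Finset.card_univ, Fintype.card_fin, nsmul_eq_mul]
      field_simp
    simp only [h3] at h2
    rwa [h2.unique (hs l)] at h1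
  have hfinal : HasSum s S := hE.sigma hfib
  have hprod := (Complex.hasSum_ofReal.2 hfinal).cexp
  rw [hdet, ← Complex.ofReal_inv, ← Real.exp_neg, neg_neg, Complex.ofReal_exp]
  refine hprod.congr_fun fun l => ?_
  rw [zpow_neg, zpow_ofNat, hexp l, ← Real.exp_neg, neg_neg, Complex.ofReal_exp]
  rfl

end CyclicProd

end QuatZeta

/-! ### The theorem for graphs -/

theorem theorem5p5 {V : Type*} [Fintype V] [DecidableEq V] (G : SimpleGraph V)
    [DecidableRel G.Adj] (W : Matrix V V ℍ[ℝ]) (hW : QuatZeta.IsWeightedMatrix G W)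
    (m : ℕ) (hm : m = G.edgeFinset.card) (e : Fin (2 * m) ≃ G.Dart) (t : ℍ[ℝ])
    (ht : ∀ a b : G.Dart, ‖t * QuatZeta.wTilde G W a b‖ < 1 / (8 * (m : ℝ) ^ 2)) :
    QuatZeta.Sdet (1 - t • (QuatZeta.Bw G W - QuatZeta.J0 G)) ≠ 0 ∧
    (∀ l : List (Fin (2 * m)), QuatZeta.IsLyndon l →
      1 - QuatZeta.cyclicProd (fun i j => t * QuatZeta.wTilde G W (e i) (e j)) l ≠ 0) ∧
    HasProd
      (fun l : {l : List (Fin (2 * m)) // QuatZeta.IsLyndon l} =>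
        ((‖1 - QuatZeta.cyclicProd (fun i j => t * QuatZeta.wTilde G W (e i) (e j)) l.1‖
          ^ (-2 : ℤ) : ℝ) : ℂ))
      (QuatZeta.zeta G W t) := by
  -- The left side is `1/(2m)` for `m ≥ 1`, and `0` for `m = 0`.
  have hn : 2 * ((Fintype.card (Fin (2 * m)) : ℝ) * (1 / (8 * (m : ℝ) ^ 2))) < 1 := by
    rw [Fintype.card_fin]
    push_cast
    rcases m.eq_zero_or_pos with rfl | hpos
    · simp
    · have h1 : (1 : ℝ) ≤ m := by exact_mod_cast hpos
      rw [mul_one_div, mul_div_assoc', div_lt_one (by positivity)]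
      nlinarith
  have h := QuatZeta.hasProd_lyndon
    (a := fun i j : Fin (2 * m) => t * QuatZeta.wTilde G W (e i) (e j))
    (by positivity) (fun i j => (ht (e i) (e j)).le) hn
  have hsub : (1 - t • (QuatZeta.Bw G W - QuatZeta.J0 G)).submatrix e e =
      1 - Matrix.of fun i j : Fin (2 * m) => t * QuatZeta.wTilde G W (e i) (e j) := by
    rw [Matrix.submatrix_sub, Pi.sub_apply, Pi.sub_apply, Matrix.submatrix_one_equiv]
    rfl
  have hdet : QuatZeta.Sdet (1 - t • (QuatZeta.Bw G W - QuatZeta.J0 G)) =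
      QuatZeta.Sdet (1 - Matrix.of fun i j : Fin (2 * m) =>
        t * QuatZeta.wTilde G W (e i) (e j)) := by
    rw [← hsub, QuatZeta.Sdet_submatrix_equiv]
  rw [QuatZeta.zeta, hdet]
  exact h
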